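/- **Notation.** Let $m$ be a cardinal, let $\mathbb C^m$ denote the Hilbert space $\ell^2$ over an index set of cardinality $m$ (the usual Euclidean space if $m$ is finite), with $\langle\lambda,\mu\rangle=\sum_j\lambda_j\overline{\mu_j}$, and let $\mathbb B_m$ be its open unit ball. The Drury–Arveson kernel is $a_m(\lambda,\mu)=\frac1{1-\langle\lambda,\mu\rangle}$ on $\mathbb B_m$. For a positive scalar kernel $k$ on a set $\Omega$, a $\mathbb C^{p\times q}$-valued function $s$ on $\Omega$ is a *Schur multiplier* of the reproducing kernel Hilbert space $\mathcal H_k$ if $(I_p-s(z)s(w)^*)\,k(z,w)$ is a positive kernel on $\Omega$; the set of these is $\mathcal M_k^{p\times q}$, and $\mathcal M_k=\mathcal M_k^{1\times1}$ ($p,q$ may be infinite cardinals, matrices then being bounded operators). For $\alpha\in\mathbb B_m$ the Blaschke factor is the $\mathbb C^{1\times m}$-valued function $$b_\alpha(\lambda)=\frac{(1-\langle\alpha,\alpha\rangle)^{1/2}}{1-\langle\lambda,\alpha\rangle}\,(\lambda-\alpha)\,(I_m-\alpha^*\alpha)^{-1/2},\qquad \lambda\in\mathbb B_m,$$ where $\lambda,\alpha$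 are regarded as row vectors. A kernel $k$ on $\Omega$ is irreducible if $k(z,w)\ne0$ for all $z,w\in\Omega$ and $k(\cdot,w)$, $k(\cdot,v)$ are linearly independent whenever $v\ne w$. An irreducible positive kernel $k$ on $\Omega$ is a complete Nevanlinna–Pick (CNP) kernel with associated map $\beta$ if, for some cardinal $m$, $\beta:\Omega\to\mathbb B_m$ is injective and there is a nowhere vanishing function $\delta:\Omega\to\mathbb C$ with $$k(z,w)=\delta(z)\,\overline{\delta(w)}\,a_m(\beta(z),\beta(w)),\qquad z,w\in\Omega.$$ **Theorem.** Let $\Omega$ be an open subset of the open unit ball (of some $\mathbb C^d$, $d$ any cardinal), and let $k$ be a CNP kernel on $\Omega$ with associated map $\beta:\Omega\to\mathbb B_m$. 1. A function $S:\Omega\to\mathbb C$ belongs to $\mathcal M_k$ if and only if there is $G\in\mathcal M_{a_m}$ such that $S(z)=G(\beta(z))$ for all $z\in\Omega$. 2. Let $S\in\mathcal M_k$ and $w_0\in\Omega$. Then $S(w_0)=0$ if and only if there is $G_1\in\mathcal M_{a_m}^{m\times1}$ such that $$S(z)=b_{\beta(w_0)}(\beta(z))\,G_1(\beta(z))\qquad\text{for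 all } z\in\Omega.$$ 3. (Scalar ball version.) Let $s\in\mathcal M_{a_m}$ and $\nu\in\mathbb B_m$. Then $s(\nu)=0$ if and only if there is $s_\nu\in\mathcal M_{a_m}^{m\times1}$ such that $s(\lambda)=b_\nu(\lambda)\,s_\nu(\lambda)$ for all $\lambda\in\mathbb B_m$. -/

import Mathlib

open scoped lp

noncomputable section

/-- The open unit ball `𝔹_m` of `ℂ^m = ℓ²(ι, ℂ)`, where `m` is the cardinality of `ι`
(for finite `ι` this is the Euclidean space `ℂ^m`). -/
abbrev DABall (ι : Type*) : Type _ := Metric.ball (0 : ℓ²(ι, ℂ)) 1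

/-- The Drury-Arveson kernel `a_m(l, μ) = 1 / (1 - ⟨l, μ⟩)`, with `⟨l, μ⟩ = ∑ l_j conj μ_j`. Mathlib's
inner product is conjugate-linear in its first argument, whence the swap. -/
def druryArveson (ι : Type*) (l μ : DABall ι) : ℂ :=
  1 / (1 - inner ℂ (μ : ℓ²(ι, ℂ)) (l : ℓ²(ι, ℂ)))

open scoped ComplexOrder in
/-- A scalar kernel is positive if all its finite sections are positive semidefinite. -/
def IsPositiveKernel {X : Type*} (k : X → X → ℂ) : Prop :=
  (Matrix.of k).PosSemidef

/-- An irreducible kernel: it never vanishes, and the kernel functions `k_w = k(·, w)` and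
`k_v = k(·, v)` are linearly independent if `v ≠ w`. -/
def IsIrreducibleKernel {X : Type*} (k : X → X → ℂ) : Prop :=
  (∀ z w, k z w ≠ 0) ∧
    ∀ w v, v ≠ w → LinearIndependent ℂ ![fun z => k z w, fun z => k z v]

/-- `k` is an (irreducible) complete Nevanlinna-Pick kernel on `X` with associated map
`β : X → 𝔹_m`: the map `β` is injective and `k(z, w) = δ(z) conj(δ(w)) a_m(β(z), β(w))` for some
nowhere vanishing `δ`. -/
structure IsCNPKernelWith {X ι : Type*} (k : X → X → ℂ) (β : X → DABall ι) : Prop where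
  positive : IsPositiveKernel k
  irreducible : IsIrreducibleKernel k
  injective : Function.Injective β
  factorization : ∃ δ : X → ℂ, (∀ z, δ z ≠ 0) ∧
    ∀ z w, k z w = δ z * starRingEnd ℂ (δ w) * druryArveson ι (β z) (β w)

/-- A function `s` on `X` whose values are operators `F → E` between Hilbert spaces
(`p × q` matrices for `F = ℂ^q`, `E = ℂ^p`) is a Schur multiplier of the reproducing kernel Hilbert
space of `k` if `(I - s(z) s(w)^*) k(z, w)` is a positive kernel. -/
def IsSchurMultiplier {X E F : Type*}
    [NormedAddCommGroup E] [InnerProductSpace ℂ E] [CompleteSpace E]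
    [NormedAddCommGroup F] [InnerProductSpace ℂ F] [CompleteSpace F]
    (k : X → X → ℂ) (s : X → F →L[ℂ] E) : Prop :=
  (Matrix.of fun z w =>
    k z w • (1 - s z ∘L ContinuousLinearMap.adjoint (s w) : E →L[ℂ] E)).PosSemidef

/-- Schur multipliers with values in the columns `E`, that is, in the operators `ℂ → E`, `c ↦ c • x`.
For `E = ℂ` these are the scalar (`1 × 1`) Schur multipliers, for `E = ℓ²(ι, ℂ)` the `m × 1` ones. -/
def IsColumnSchurMultiplier {X E : Type*}
    [NormedAddCommGroup E] [InnerProductSpace ℂ E] [CompleteSpace E]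
    (k : X → X → ℂ) (s : X → E) : Prop :=
  IsSchurMultiplier k fun z => ContinuousLinearMap.toSpanSingleton ℂ (s z)

/-- The product of the `1 × m` row `x` and the `m × 1` column `y` (an absolutely convergent sum,
bilinear in `x` and `y`). -/
def rowMulColumn {ι : Type*} (x y : ℓ²(ι, ℂ)) : ℂ :=
  ∑' j, x j * y j

/-- The operator `(I - α^* α)^{-1/2}` acting on rows by multiplication from the right, for a row `α`
in a Hilbert space `E` (below `E = ℓ²(ι, ℂ)`). The matrix `α^* α` sends a row `v` to
`v α^* α = ⟨v, α⟩ α`; the power is the one of the continuous functional calculus. -/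
def defectInvSqrt {E : Type*} [NormedAddCommGroup E] [InnerProductSpace ℂ E] [CompleteSpace E]
    (α : E) : E →L[ℂ] E :=
  (1 - InnerProductSpace.rankOne ℂ α α : E →L[ℂ] E) ^ (-(1 / 2) : ℝ)

/-- The Blaschke factor, a `1 × m` row:
`b_α(l) = (1 - ⟨α, α⟩)^{1/2} / (1 - ⟨l, α⟩) * (l - α) (I - α^* α)^{-1/2}`. -/
def blaschke {ι : Type*} (α l : DABall ι) : ℓ²(ι, ℂ) :=
  ((Real.sqrt (1 - ‖(α : ℓ²(ι, ℂ))‖ ^ 2) : ℂ) /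
      (1 - inner ℂ (α : ℓ²(ι, ℂ)) (l : ℓ²(ι, ℂ)))) •
    defectInvSqrt (α : ℓ²(ι, ℂ)) ((l : ℓ²(ι, ℂ)) - (α : ℓ²(ι, ℂ)))

end

/-!
Every claim rests on a Leech-type factorization for the Drury-Arveson kernel `a_m`
(`exists_isColumnSchurMultiplier_inner_eq`). Given a map `γ : Y → 𝔹_m`, a row-valued `b` and a
scalar `s` on `Y` for which `(b(x) b(y)^* - s(x) s(y)^*) a_m(γ(x), γ(y))` is positive, there is a
column Schur multiplier `G` of `a_m`, defined on the whole ball, with `s = b · (G ∘ γ)`.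

The proof is a lurking isometry argument. A positive kernel is a Gram kernel `⟨ψ(x), ψ(y)⟩`
(`exists_eq_inner_of_posSemidef`). With `Z(l) = (l_j I)_j`, the positivity hypothesis says that the
vectors `(b(y)^*, Z(γ(y))^* ψ(y))` have the same Gram kernel as the vectors `(s(y)^*, ψ(y))`, so a
contraction `V` maps the former to the latter (`exists_contraction_of_inner_eq`). For every `l` in
the ball and every vector `e`, the state equation `V (e, Z(l)^* h) = (·, h)` has exactly one
solution `h` (`exists_resolvent`), and the first component of the resulting value of `V` is `G(l)^*
e`. The defect kernel of `V` is positive, and multiplying it by `a_m` with the Schur product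
theorem shows that `G` is a Schur multiplier. Uniqueness of the solution gives the factorization on
`Y`.

* With `b = 1`, multipliers of `a_m` restricted along `β` extend to the ball
  (`exists_isColumnSchurMultiplier_extension`); the factor `δ(z) conj δ(w)` does not affect
  positivity.
* The kernel `b_ν(l) b_ν(μ)^* a_m(l, μ)` is `a_m(l, μ) - a_m(l, ν) a_m(ν, μ) / a_m(ν, ν)`, by
  `one_sub_inner_blaschke`. If `s(ν) = 0`, then `K = (1 - s s^*) a_m` has `K(·, ν) = a_m(·, ν)`, so
  `(b_ν b_ν^* - s s^*) a_m` is the Schur complement of `K` at `ν` and hence positive; this gives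
  `exists_blaschke_factor`. Conversely `b_ν(ν) = 0`.

Mathlib's inner product is conjugate-linear in its first argument. Rows are therefore encoded by
their adjoints: in the factorization theorem, `b y : E` stands for the vector `b(y)^*`, and the
product `b(y) G` becomes `⟨b y, G⟩`.
-/

noncomputable section

open ComplexConjugate

open scoped ComplexOrder

universe u

/-! ### Positive kernels -/

theorem posSemidef_congr {X R : Type*} [Ring R] [PartialOrder R] [StarRing R] {K L : Matrix X X R}
    (hK : K.PosSemidef) (h : ∀ x y, K x y = L x y) : L.PosSemidef :=
  Matrix.ext h ▸ hK

theorem posSemidef_of_tendsto {X : Type*} {K : ℕ → Matrix X X ℂ} {L : Matrix X X ℂ}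
    (hK : ∀ n, (K n).PosSemidef)
    (h : ∀ x y, Filter.Tendsto (fun n => K n x y) Filter.atTop (nhds (L x y))) :
    L.PosSemidef := by
  constructor
  · ext x y
    refine tendsto_nhds_unique (f := fun n => K n x y) (l := Filter.atTop) ?_ (h x y)
    simp only [Matrix.conjTranspose_apply]
    refine ((h y x).star).congr fun n => ?_
    exact (hK n).1.apply x y
  · intro c
    refine ge_of_tendsto' (f := fun n => c.sum fun i xi => c.sum fun j xj => star xi * K n i j * xj)
      (x := Filter.atTop) ?_ fun n => (hK n).2 c
    simp only [Finsupp.sum]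
    refine tendsto_finsetSum _ fun i _ => tendsto_finsetSum _ fun j _ => ?_
    exact ((h i j).const_mul _).mul_const _

/-- The defect kernel `⟨u, v⟩ - ⟨V u, V v⟩` of a contraction `V` is positive. -/
theorem posSemidef_defect {X H₁ H₂ : Type*}
    [NormedAddCommGroup H₁] [InnerProductSpace ℂ H₁]
    [NormedAddCommGroup H₂] [InnerProductSpace ℂ H₂]
    (V : H₁ →L[ℂ] H₂) (hV : ∀ u, ‖V u‖ ≤ ‖u‖) (u : X → H₁) :
    (Matrix.of fun x y => inner ℂ (u x) (u y) - inner ℂ (V (u x)) (V (u y))).PosSemidef := by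
  constructor
  · ext x y; simp
  · intro c
    let w := c.sum fun x t => t • u x
    have hw : (c.sum fun i xi => c.sum fun j xj => star xi *
        (Matrix.of fun x y => inner ℂ (u x) (u y) - inner ℂ (V (u x)) (V (u y))) i j * xj) =
        inner ℂ w w - inner ℂ (V w) (V w) := by
      simp only [w, Finsupp.sum, map_sum, sum_inner, inner_sum, map_smul,
        inner_smul_left, inner_smul_right, Matrix.of_apply, ← Finset.sum_sub_distrib,
        RCLike.star_def, Finset.mul_sum]
      rw [Finset.sum_comm]
      refine Finset.sum_congr rfl fun i _ => Finset.sum_congr rfl fun j _ => ?_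
      ring
    rw [hw, inner_self_eq_norm_sq_to_K, inner_self_eq_norm_sq_to_K, sub_nonneg]
    have := hV w
    norm_cast
    gcongr

theorem posSemidef_inner {X H : Type*} [NormedAddCommGroup H] [InnerProductSpace ℂ H]
    (ψ : X → H) : (Matrix.of fun x y => inner ℂ (ψ x) (ψ y)).PosSemidef :=
  posSemidef_congr (posSemidef_defect (0 : H →L[ℂ] H) (by simp) ψ) fun x y => by simp

theorem posSemidef_mul {X : Type*} {K L : Matrix X X ℂ}
    (hK : K.PosSemidef) (hL : L.PosSemidef) :
    (Matrix.of fun x y => K x y * L x y).PosSemidef :=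
  hK.hadamard hL

/-- A bounded-operator-valued kernel is positive if and only if the scalar kernel of its matrix
coefficients is. -/
theorem posSemidef_iff_posSemidef_inner {X E : Type*}
    [NormedAddCommGroup E] [InnerProductSpace ℂ E] [CompleteSpace E]
    {K : Matrix X X (E →L[ℂ] E)} :
    K.PosSemidef ↔
      (Matrix.of fun p q : X × E => inner ℂ p.2 (K p.1 q.1 q.2)).PosSemidef := by
  constructor
  · intro h
    have : Fact K.PosSemidef := ⟨h⟩
    refine posSemidef_congr
      (posSemidef_inner fun p : X × E => RKHS.kerFun (RKHS.OfKernel K) p.1 p.2) fun p q => ?_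
    have h1 := h.1.apply p.1 q.1
    simp only [Matrix.of_apply]
    rw [← RKHS.kernel_inner, RKHS.OfKernel.kernel_ofKernel, ← h1,
      ContinuousLinearMap.star_eq_adjoint, ContinuousLinearMap.adjoint_inner_right]
  · intro h
    have hH : K.IsHermitian := by
      ext x y e
      refine ext_inner_left ℂ fun f => ?_
      have := h.1.apply (x, f) (y, e)
      simp only [Matrix.of_apply, RCLike.star_def, inner_conj_symm] at this
      rw [Matrix.conjTranspose_apply, ContinuousLinearMap.star_eq_adjoint,
        ContinuousLinearMap.adjoint_inner_right, this]
    have h0 : K.IsHermitian ∧ ∀ f : X × E →₀ ℂ, 0 ≤ RCLike.re (f.sum fun xv z =>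
        f.sum fun xv' w => conj z * w * inner ℂ (K xv'.1 xv.1 xv.2) xv'.2) := by
      refine ⟨hH, fun c => ?_⟩
      have h2 := (Complex.le_def.1 (h.2 c)).1
      rw [Complex.zero_re] at h2
      refine h2.trans_eq ?_
      rw [RCLike.re_eq_complex_re]
      congr 1
      refine Finsupp.sum_congr fun p _ => Finsupp.sum_congr fun q _ => ?_
      have h3 := hH.apply p.1 q.1
      simp only [Matrix.of_apply]
      rw [← h3, ContinuousLinearMap.star_eq_adjoint, ContinuousLinearMap.adjoint_inner_right]
      simp only [RCLike.star_def]
      ring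
    exact (RKHS.posSemidef_tfae.out 1 0).1 h0

/-- A positive scalar kernel is the Gram kernel of a family of vectors of a Hilbert space, namely of
the kernel functions in the reproducing kernel Hilbert space. -/
theorem exists_eq_inner_of_posSemidef {X : Type u} {K : Matrix X X ℂ} (h : K.PosSemidef) :
    ∃ (H : Type u) (_ : NormedAddCommGroup H) (_ : InnerProductSpace ℂ H) (_ : CompleteSpace H)
      (ψ : X → H), ∀ x y, K x y = inner ℂ (ψ x) (ψ y) := by
  let K' : Matrix X X (ℂ →L[ℂ] ℂ) := Matrix.of fun x y => K x y • 1
  have h' : K'.PosSemidef := by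
    rw [posSemidef_iff_posSemidef_inner]
    refine posSemidef_congr (posSemidef_mul (h.submatrix (Prod.fst : X × ℂ → X))
      (posSemidef_inner (Prod.snd : X × ℂ → ℂ))) fun p q => ?_
    simp [K']
    ring
  have : Fact K'.PosSemidef := ⟨h'⟩
  refine ⟨RKHS.OfKernel K', inferInstance, inferInstance, inferInstance,
    fun x => RKHS.kerFun (RKHS.OfKernel K') x 1, fun x y => ?_⟩
  rw [← RKHS.kernel_inner, RKHS.OfKernel.kernel_ofKernel, ← inner_conj_symm]
  have := h.1.apply x y
  simpa [K'] using this.symm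

/-! ### Contractions between families of vectors -/

/-- Families of vectors with the same Gram kernel correspond under a contraction: the isometry
between their closed spans, preceded by the orthogonal projection onto the first one. -/
theorem exists_contraction_of_inner_eq {X H₁ H₂ : Type*}
    [NormedAddCommGroup H₁] [InnerProductSpace ℂ H₁] [CompleteSpace H₁]
    [NormedAddCommGroup H₂] [InnerProductSpace ℂ H₂] [CompleteSpace H₂]
    (f : X → H₁) (g : X → H₂) (h : ∀ x y, inner ℂ (f x) (f y) = inner ℂ (g x) (g y)) :
    ∃ V : H₁ →L[ℂ] H₂, (∀ u, ‖V u‖ ≤ ‖u‖) ∧ ∀ x, V (f x) = g x := by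
  let F := Finsupp.linearCombination ℂ f
  let G := Finsupp.linearCombination ℂ g
  have hFG : ∀ c, ‖G c‖ = ‖F c‖ := fun c => by
    have : inner ℂ (G c) (G c) = inner ℂ (F c) (F c) := by
      simp only [F, G, Finsupp.linearCombination_apply, Finsupp.sum_inner, Finsupp.inner_sum,
        inner_smul_left, inner_smul_right, h]
    rw [@norm_eq_sqrt_re_inner ℂ, @norm_eq_sqrt_re_inner ℂ, this]
  let S := (LinearMap.range F).topologicalClosure
  have : CompleteSpace S := (LinearMap.range F).isClosed_topologicalClosure.completeSpace_coe
  let e : (X →₀ ℂ) →ₗ[ℂ] S := F.codRestrict S fun c =>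
    (LinearMap.range F).le_topologicalClosure ⟨c, rfl⟩
  have he : DenseRange e := by
    rw [DenseRange, Subtype.dense_iff]
    intro x hx
    have : (LinearMap.range F : Set H₁) ⊆ Subtype.val '' Set.range e := by
      rintro _ ⟨c, rfl⟩
      exact ⟨e c, ⟨c, rfl⟩, rfl⟩
    exact closure_mono this hx
  have hb : ∀ c, ‖G c‖ ≤ 1 * ‖e c‖ := fun c => by
    rw [one_mul, hFG]; rfl
  refine ⟨(G.extendOfNorm e) ∘L S.orthogonalProjectionOnto, fun u => ?_, fun x => ?_⟩
  · refine (LinearMap.norm_extendOfNorm_apply_le he 1 hb _).trans ?_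
    rw [one_mul]
    exact S.norm_orthogonalProjectionOnto_apply_le u
  · have h1 : f x = e (Finsupp.single x 1) := by simp [e, F]
    have h2 := LinearMap.extendOfNorm_eq he ⟨1, hb⟩ (Finsupp.single x 1)
    rw [ContinuousLinearMap.comp_apply, h1,
      Submodule.orthogonalProjectionOnto_mem_subspace_eq_self, h2]
    simp [G]

/-! ### The row of coordinates -/

section Row

variable {ι H : Type*} [NormedAddCommGroup H] [InnerProductSpace ℂ H]

theorem memℓp_conj_smul (l : ℓ²(ι, ℂ)) (h : H) : Memℓp (fun j => conj (l j) • h) 2 := by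
  have := lp.memℓp l
  rw [memℓp_gen_iff (by norm_num)] at this ⊢
  refine (this.mul_right (‖h‖ ^ (2 : ENNReal).toReal)).congr fun j => ?_
  rw [norm_smul, RCLike.norm_conj, Real.mul_rpow (norm_nonneg _) (norm_nonneg _)]

/-- The vector `(conj l_j • h)_j` of `ℓ²(ι, H)`. -/
def conjTensor (l : ℓ²(ι, ℂ)) (h : H) : lp (fun _ : ι => H) 2 :=
  ⟨fun j => conj (l j) • h, memℓp_conj_smul l h⟩

theorem inner_conjTensor (l μ : ℓ²(ι, ℂ)) (g h : H) :
    inner ℂ (conjTensor l g) (conjTensor μ h) = inner ℂ μ l * inner ℂ g h := by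
  rw [lp.inner_eq_tsum, lp.inner_eq_tsum, ← tsum_mul_right]
  refine tsum_congr fun j => ?_
  simp only [conjTensor, inner_smul_left, inner_smul_right, RCLike.inner_apply]
  simp
  ring

theorem norm_conjTensor (l : ℓ²(ι, ℂ)) (h : H) : ‖conjTensor l h‖ = ‖l‖ * ‖h‖ := by
  have := inner_conjTensor l l h h
  simp only [inner_self_eq_norm_sq_to_K] at this
  norm_cast at this
  rw [← mul_pow] at this
  exact (sq_eq_sq₀ (norm_nonneg _) (by positivity)).1 this

/-- The operator `h ↦ (conj l_j • h)_j`, the adjoint of the row `(l_j I)_j`. -/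
def rowAdjoint (H : Type*) [NormedAddCommGroup H] [InnerProductSpace ℂ H] (l : ℓ²(ι, ℂ)) :
    H →L[ℂ] lp (fun _ : ι => H) 2 :=
  LinearMap.mkContinuous
    { toFun := conjTensor l
      map_add' := fun g h => by ext j; exact smul_add _ _ _
      map_smul' := fun c h => by ext j; simp [conjTensor, smul_smul, mul_comm] }
    ‖l‖ fun h => (norm_conjTensor l h).le

theorem inner_rowAdjoint (l μ : ℓ²(ι, ℂ)) (g h : H) :
    inner ℂ (rowAdjoint H l g) (rowAdjoint H μ h) = inner ℂ μ l * inner ℂ g h :=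
  inner_conjTensor l μ g h

theorem norm_rowAdjoint_apply (l : ℓ²(ι, ℂ)) (h : H) : ‖rowAdjoint H l h‖ = ‖l‖ * ‖h‖ :=
  norm_conjTensor l h

end Row

/-! ### The Drury-Arveson kernel -/

section DruryArveson

variable {ι : Type*}

theorem norm_inner_lt_one (l μ : DABall ι) :
    ‖inner ℂ (μ : ℓ²(ι, ℂ)) (l : ℓ²(ι, ℂ))‖ < 1 := by
  have h1 := mem_ball_zero_iff.1 l.2
  have h2 := mem_ball_zero_iff.1 μ.2
  refine (norm_inner_le_norm _ _).trans_lt ?_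
  nlinarith [norm_nonneg (l : ℓ²(ι, ℂ)), norm_nonneg (μ : ℓ²(ι, ℂ))]

theorem one_sub_inner_ne_zero (l μ : DABall ι) :
    1 - inner ℂ (μ : ℓ²(ι, ℂ)) (l : ℓ²(ι, ℂ)) ≠ 0 := fun h => by
  have := norm_inner_lt_one l μ
  rw [← sub_eq_zero.1 h] at this
  simp at this

theorem druryArveson_ne_zero (l μ : DABall ι) : druryArveson ι l μ ≠ 0 :=
  one_div_ne_zero (one_sub_inner_ne_zero l μ)

/-- By the geometric series, the Drury-Arveson kernel is the sum of the entrywise powers of a Gram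
kernel. -/
theorem isPositiveKernel_druryArveson (ι : Type*) : IsPositiveKernel (druryArveson ι) := by
  have hG : (Matrix.of fun l μ : DABall ι =>
      inner ℂ (μ : ℓ²(ι, ℂ)) (l : ℓ²(ι, ℂ))).PosSemidef :=
    (posSemidef_inner (fun l : DABall ι => (l : ℓ²(ι, ℂ)))).transpose
  have hpow : ∀ n : ℕ, (Matrix.of fun l μ : DABall ι =>
      (inner ℂ (μ : ℓ²(ι, ℂ)) (l : ℓ²(ι, ℂ))) ^ n).PosSemidef := by
    intro n
    induction n with
    | zero => exact posSemidef_congr (posSemidef_inner fun _ => (1 : ℂ)) fun l μ => by simp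
    | succ n ih => exact posSemidef_congr (posSemidef_mul ih hG) fun l μ => (pow_succ _ _).symm
  refine posSemidef_of_tendsto
    (K := fun n => Matrix.of fun l μ : DABall ι =>
      ∑ k ∈ Finset.range n, (inner ℂ (μ : ℓ²(ι, ℂ)) (l : ℓ²(ι, ℂ))) ^ k) (fun n => ?_) ?_
  · exact posSemidef_congr (Matrix.posSemidef_sum (Finset.range n) fun k _ => hpow k) fun l μ => by
      simp [Matrix.sum_apply]
  · intro l μ
    simpa [druryArveson] using
      (hasSum_geometric_of_norm_lt_one (norm_inner_lt_one l μ)).tendsto_sum_nat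

end DruryArveson

/-! ### Leech factorization -/

section Leech

variable {ι E H : Type*}
  [NormedAddCommGroup E] [InnerProductSpace ℂ E]
  [NormedAddCommGroup H] [InnerProductSpace ℂ H] [CompleteSpace H]

/-- If `C e + D k` is the second component of `V (e, k)`, the state equation is
`h = C e + D Z(l)^* h`. As `D Z(l)^*` has norm at most `‖l‖ < 1`, its only solution is
`h = (I - D Z(l)^*)⁻¹ C e`. -/
theorem exists_resolvent
    (V : WithLp 2 (E × lp (fun _ : ι => H) 2) →L[ℂ] WithLp 2 (ℂ × H)) (hV : ∀ u, ‖V u‖ ≤ ‖u‖)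
    (l : DABall ι) :
    ∃ R : E →L[ℂ] H, ∀ e h,
      h = (V (WithLp.toLp 2 (e, rowAdjoint H (l : ℓ²(ι, ℂ)) h))).snd ↔ h = R e := by
  let i₁ : E →L[ℂ] WithLp 2 (E × lp (fun _ : ι => H) 2) :=
    (WithLp.prodContinuousLinearEquiv 2 ℂ E (lp (fun _ : ι => H) 2)).symm ∘L
      ContinuousLinearMap.inl ℂ E (lp (fun _ : ι => H) 2)
  let i₂ : lp (fun _ : ι => H) 2 →L[ℂ] WithLp 2 (E × lp (fun _ : ι => H) 2) :=
    (WithLp.prodContinuousLinearEquiv 2 ℂ E (lp (fun _ : ι => H) 2)).symm ∘L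
      ContinuousLinearMap.inr ℂ E (lp (fun _ : ι => H) 2)
  let C : E →L[ℂ] H := WithLp.sndL 2 ℂ ℂ H ∘L V ∘L i₁
  let T : H →L[ℂ] H := WithLp.sndL 2 ℂ ℂ H ∘L V ∘L i₂ ∘L rowAdjoint H (l : ℓ²(ι, ℂ))
  have hT : ‖T‖ < 1 := by
    refine (T.opNorm_le_bound (norm_nonneg (l : ℓ²(ι, ℂ))) fun h => ?_).trans_lt
      (mem_ball_zero_iff.1 l.2)
    rw [← norm_rowAdjoint_apply]
    refine (WithLp.norm_snd_le _ _).trans ((hV _).trans_eq ?_)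
    exact WithLp.norm_toLp_snd 2 E _ _
  have hsplit : ∀ e h, (V (WithLp.toLp 2 (e, rowAdjoint H (l : ℓ²(ι, ℂ)) h))).snd = C e + T h := by
    intro e h
    have : WithLp.toLp 2 (e, rowAdjoint H (l : ℓ²(ι, ℂ)) h) = i₁ e + i₂ (rowAdjoint H l h) := by
      refine (WithLp.toLp_add 2 (e, 0) (0, rowAdjoint H (l : ℓ²(ι, ℂ)) h) ▸ ?_)
      simp
    rw [this, map_add]
    rfl
  have hu : IsUnit (1 - T) := (Units.oneSub T hT).isUnit
  refine ⟨Ring.inverse (1 - T) ∘L C, fun e h => ?_⟩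
  rw [hsplit]
  have h1 : Ring.inverse (1 - T) * (1 - T) = 1 := Ring.inverse_mul_cancel _ hu
  have h2 : (1 - T) * Ring.inverse (1 - T) = 1 := Ring.mul_inverse_cancel _ hu
  constructor
  · intro heq
    have h3 : C e = (1 - T) h := by
      rw [sub_apply, one_apply_eq_self, eq_sub_iff_add_eq]
      exact heq.symm
    rw [ContinuousLinearMap.comp_apply, h3]
    exact (DFunLike.congr_fun h1 h).symm
  · rintro rfl
    have h3 := DFunLike.congr_fun h2 (C e)
    rw [mul_apply_eq_comp, sub_apply,
      one_apply_eq_self, one_apply_eq_self, sub_eq_iff_eq_add] at h3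
    exact h3

/-- **Leech factorization** for the Drury-Arveson kernel. The vector `b y` is the adjoint of a row,
and the family `ψ` realizes the positive kernel `(b b^* - s s^*) a_m` as a Gram kernel. -/
theorem exists_isColumnSchurMultiplier_inner_eq [CompleteSpace E] {Y : Type*}
    (γ : Y → DABall ι) (b : Y → E) (s : Y → ℂ) (ψ : Y → H)
    (h : ∀ x y, inner ℂ (b x) (b y) - s x * conj (s y) =
      (1 - inner ℂ (γ y : ℓ²(ι, ℂ)) (γ x : ℓ²(ι, ℂ))) * inner ℂ (ψ x) (ψ y)) :
    ∃ G : DABall ι → E, IsColumnSchurMultiplier (druryArveson ι) G ∧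
      ∀ y, s y = inner ℂ (b y) (G (γ y)) := by
  obtain ⟨V, hV, hVfg⟩ := exists_contraction_of_inner_eq
    (fun y => WithLp.toLp 2 (b y, rowAdjoint H (γ y : ℓ²(ι, ℂ)) (ψ y)))
    (fun y => WithLp.toLp 2 (conj (s y), ψ y)) fun x y => by
      simp only [WithLp.prod_inner_apply, inner_rowAdjoint, RCLike.inner_apply, RCLike.conj_conj]
      linear_combination h x y
  choose R hR using exists_resolvent V hV
  let U : DABall ι → E →L[ℂ] WithLp 2 (E × lp (fun _ : ι => H) 2) := fun l =>
    (WithLp.prodContinuousLinearEquiv 2 ℂ E (lp (fun _ : ι => H) 2)).symm ∘L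
      (ContinuousLinearMap.id ℂ E).prod (rowAdjoint H (l : ℓ²(ι, ℂ)) ∘L R l)
  have hU : ∀ l e, U l e = WithLp.toLp 2 (e, rowAdjoint H (l : ℓ²(ι, ℂ)) (R l e)) :=
    fun l e => rfl
  -- `P l` is the functional `G(l)^*`, the transfer function of `V` at `l`.
  let P : DABall ι → E →L[ℂ] ℂ := fun l => WithLp.fstL 2 ℂ ℂ H ∘L V ∘L U l
  let G : DABall ι → E := fun l => (InnerProductSpace.toDual ℂ E).symm (P l)
  have hG : ∀ l e, inner ℂ (G l) e = P l e := fun l e =>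
    InnerProductSpace.toDual_symm_apply
  have hVU : ∀ l e, V (U l e) = WithLp.toLp 2 (P l e, R l e) := by
    intro l e
    have h1 := (hR l e (R l e)).2 rfl
    have h2 : (V (U l e)).snd = R l e := h1.symm
    rw [← h2]
    rfl
  refine ⟨G, ?_, fun y => ?_⟩
  · refine posSemidef_iff_posSemidef_inner.2 ?_
    have hN := posSemidef_defect V hV fun p : DABall ι × E => U p.1 p.2
    have hA := (isPositiveKernel_druryArveson ι).submatrix (Prod.fst : DABall ι × E → DABall ι)
    -- With `N` the defect kernel of `V` on the vectors `U l e`, one has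
    -- `(I - G G^*) a_m = a_m N + R^* R`.
    refine posSemidef_congr ((posSemidef_mul hA hN).add
      (posSemidef_inner fun p : DABall ι × E => R p.1 p.2)) fun p q => ?_
    have hadj : ContinuousLinearMap.adjoint (ContinuousLinearMap.toSpanSingleton ℂ (G q.1)) q.2 =
        P q.1 q.2 := by
      refine ext_inner_left ℂ fun c => ?_
      rw [ContinuousLinearMap.adjoint_inner_right, ContinuousLinearMap.toSpanSingleton_apply,
        inner_smul_left, hG]
      simp [mul_comm]
    have hconj : inner ℂ p.2 (G p.1) = conj (P p.1 p.2) := by rw [← hG, inner_conj_symm]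
    simp only [Matrix.add_apply, Matrix.of_apply, Matrix.submatrix_apply,
      smul_apply, sub_apply, one_apply_eq_self, ContinuousLinearMap.comp_apply, hadj,
      ContinuousLinearMap.toSpanSingleton_apply, inner_smul_right, inner_sub_right, hconj, hVU]
    simp only [hU, WithLp.prod_inner_apply, inner_rowAdjoint, RCLike.inner_apply, druryArveson]
    have := one_sub_inner_ne_zero p.1 q.1
    field_simp
    ring
  · have h1 : ψ y = R (γ y) (b y) := (hR (γ y) (b y) (ψ y)).1 (by rw [hVfg]; rfl)
    have h2 : P (γ y) (b y) = conj (s y) := by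
      change (V (U (γ y) (b y))).fst = _
      rw [hU, ← h1, hVfg]
      rfl
    rw [← inner_conj_symm, hG, h2, RCLike.conj_conj]

end Leech

/-! ### The Blaschke factor -/

section Blaschke

/-- As `(I - α^* α)^{-1/2}` is self-adjoint with square `(I - α^* α)⁻¹`, this is the
Sherman-Morrison formula `(I - α^* α)⁻¹ y = y + ⟨y, α⟩ α / (1 - ‖α‖²)`. -/
theorem inner_defectInvSqrt {E : Type*} [NormedAddCommGroup E] [InnerProductSpace ℂ E]
    [CompleteSpace E] {α : E} (hα : ‖α‖ < 1) (x y : E) :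
    inner ℂ (defectInvSqrt α x) (defectInvSqrt α y) =
      inner ℂ x y + inner ℂ x α * inner ℂ α y / (1 - ‖α‖ ^ 2 : ℝ) := by
  set A : E →L[ℂ] E := 1 - InnerProductSpace.rankOne ℂ α α with hA
  have hAapp : ∀ v, A v = v - inner ℂ α v • α := fun v => rfl
  have hunit : IsUnit A := by
    refine (Units.oneSub (InnerProductSpace.rankOne ℂ α α) ?_).isUnit
    rw [InnerProductSpace.norm_rankOne]
    nlinarith [norm_nonneg α]
  have hpos : 0 ≤ A := by
    rw [ContinuousLinearMap.nonneg_iff_isPositive, ContinuousLinearMap.isPositive_iff_complex]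
    intro v
    have h1 : inner ℂ (A v) v = ((‖v‖ ^ 2 - ‖inner ℂ α v‖ ^ 2 : ℝ) : ℂ) := by
      rw [hAapp, inner_sub_left, inner_smul_left, inner_self_eq_norm_sq_to_K, RCLike.conj_mul]
      push_cast
      rfl
    rw [h1, RCLike.re_eq_complex_re, Complex.ofReal_re]
    refine ⟨rfl, ?_⟩
    have h2 : ‖inner ℂ α v‖ ≤ ‖v‖ :=
      (norm_inner_le_norm _ _).trans (mul_le_of_le_one_left (norm_nonneg _) hα.le)
    have h3 : ‖inner ℂ α v‖ ^ 2 ≤ ‖v‖ ^ 2 := by gcongr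
    exact sub_nonneg.2 h3
  have hT : defectInvSqrt α = A ^ (-(1 / 2) : ℝ) := rfl
  have hTT : defectInvSqrt α * defectInvSqrt α * A = 1 := by
    rw [hT, ← CFC.rpow_add hunit]
    nth_rw 2 [← CFC.rpow_one A hpos]
    rw [← CFC.rpow_add hunit, ← CFC.rpow_zero A hpos]
    norm_num
  have hadj : ContinuousLinearMap.adjoint (defectInvSqrt α) = defectInvSqrt α := by
    have : 0 ≤ defectInvSqrt α := CFC.rpow_nonneg
    exact (IsSelfAdjoint.of_nonneg this)
  have hne : ((1 - ‖α‖ ^ 2 : ℝ) : ℂ) ≠ 0 := by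
    rw [Complex.ofReal_ne_zero]
    nlinarith [norm_nonneg α]
  have hw : A (y + (inner ℂ α y / (1 - ‖α‖ ^ 2 : ℝ)) • α) = y := by
    rw [hAapp, inner_add_right, inner_smul_right, inner_self_eq_norm_sq_to_K, add_sub_assoc,
      ← sub_smul, add_eq_left]
    convert zero_smul ℂ α using 2
    field_simp
    push_cast
    simp
  rw [← ContinuousLinearMap.adjoint_inner_right, hadj]
  have h4 := DFunLike.congr_fun hTT (y + (inner ℂ α y / (1 - ‖α‖ ^ 2 : ℝ)) • α)
  rw [mul_apply_eq_comp, mul_apply_eq_comp, hw,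
    one_apply_eq_self] at h4
  rw [h4, inner_add_right, inner_smul_right]
  ring

variable {ι : Type*}

/-- The identity `1 - b_α(l) b_α(μ)^* = (1 - ‖α‖²) (1 - ⟨l, μ⟩) / ((1 - ⟨l, α⟩) (1 - ⟨α, μ⟩))`. -/
theorem one_sub_inner_blaschke (α l μ : DABall ι) :
    1 - inner ℂ (blaschke α μ) (blaschke α l) =
      (1 - ‖(α : ℓ²(ι, ℂ))‖ ^ 2 : ℝ) * (1 - inner ℂ (μ : ℓ²(ι, ℂ)) (l : ℓ²(ι, ℂ))) /
        ((1 - inner ℂ (α : ℓ²(ι, ℂ)) (l : ℓ²(ι, ℂ))) *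
          (1 - inner ℂ (μ : ℓ²(ι, ℂ)) (α : ℓ²(ι, ℂ)))) := by
  have hα := mem_ball_zero_iff.1 α.2
  have hr : 0 < 1 - ‖(α : ℓ²(ι, ℂ))‖ ^ 2 := by nlinarith [norm_nonneg (α : ℓ²(ι, ℂ))]
  have hne : ((1 - ‖(α : ℓ²(ι, ℂ))‖ ^ 2 : ℝ) : ℂ) ≠ 0 := Complex.ofReal_ne_zero.2 hr.ne'
  have h1 := one_sub_inner_ne_zero l α
  have h2 := one_sub_inner_ne_zero α μ
  have hs : ((Real.sqrt (1 - ‖(α : ℓ²(ι, ℂ))‖ ^ 2) : ℝ) : ℂ) *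
      (Real.sqrt (1 - ‖(α : ℓ²(ι, ℂ))‖ ^ 2) : ℝ) = (1 - ‖(α : ℓ²(ι, ℂ))‖ ^ 2 : ℝ) := by
    rw [← Complex.ofReal_mul, Real.mul_self_sqrt hr.le]
  have hself : inner ℂ (α : ℓ²(ι, ℂ)) (α : ℓ²(ι, ℂ)) =
      1 - ((1 - ‖(α : ℓ²(ι, ℂ))‖ ^ 2 : ℝ) : ℂ) := by
    rw [inner_self_eq_norm_sq_to_K]; push_cast; simp
  simp only [blaschke, inner_smul_left, inner_smul_right, inner_defectInvSqrt hα, inner_sub_left,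
    inner_sub_right, map_div₀, map_sub, map_one, inner_conj_symm, Complex.conj_ofReal, hself]
  generalize ((1 - ‖(α : ℓ²(ι, ℂ))‖ ^ 2 : ℝ) : ℂ) = r at *
  generalize ((Real.sqrt (1 - ‖(α : ℓ²(ι, ℂ))‖ ^ 2) : ℝ) : ℂ) = q at *
  subst hs
  have hq : q ≠ 0 := left_ne_zero_of_mul hne
  field_simp
  ring

theorem blaschke_self (α : DABall ι) : blaschke α α = 0 := by
  simp [blaschke]

theorem rowMulColumn_eq_inner (x y : ℓ²(ι, ℂ)) : rowMulColumn x y = inner ℂ (star x) y := by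
  rw [lp.inner_eq_tsum]
  refine tsum_congr fun j => ?_
  rw [lp.star_apply, RCLike.inner_apply, RCLike.star_def, RCLike.conj_conj, mul_comm]

theorem inner_star_star (x y : ℓ²(ι, ℂ)) : inner ℂ (star x) (star y) = inner ℂ y x := by
  rw [lp.inner_eq_tsum, lp.inner_eq_tsum]
  refine tsum_congr fun j => ?_
  simp [mul_comm]

end Blaschke

/-! ### Scalar multipliers -/

section Scalar

/-- For `1 × 1` multipliers the operator-valued kernel of the definition, with values in
`ℂ →L[ℂ] ℂ`, may be replaced by the corresponding scalar kernel. -/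
theorem isColumnSchurMultiplier_scalar_iff {X : Type*} {k : X → X → ℂ} {S : X → ℂ} :
    IsColumnSchurMultiplier k S ↔
      (Matrix.of fun z w => k z w * (1 - S z * conj (S w))).PosSemidef := by
  have key : ∀ z w : X, ∀ c : ℂ, (k z w • (1 - ContinuousLinearMap.toSpanSingleton ℂ (S z) ∘L
      ContinuousLinearMap.adjoint (ContinuousLinearMap.toSpanSingleton ℂ (S w)) : ℂ →L[ℂ] ℂ)) c =
      k z w * (1 - S z * conj (S w)) * c := by
    intro z w c
    have hadj : ContinuousLinearMap.adjoint (ContinuousLinearMap.toSpanSingleton ℂ (S w)) c =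
        conj (S w) * c := by
      refine ext_inner_left ℂ fun d => ?_
      rw [ContinuousLinearMap.adjoint_inner_right]
      simp
      ring
    simp [hadj]
    ring
  rw [IsColumnSchurMultiplier, IsSchurMultiplier, posSemidef_iff_posSemidef_inner]
  constructor
  · intro h
    refine posSemidef_congr (h.submatrix fun z : X => (z, (1 : ℂ))) fun z w => ?_
    rw [Matrix.submatrix_apply, Matrix.of_apply, Matrix.of_apply, key]
    simp
  · intro h
    refine posSemidef_congr (posSemidef_mul (h.submatrix (Prod.fst : X × ℂ → X))
      (posSemidef_inner (Prod.snd : X × ℂ → ℂ))) fun p q => ?_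
    simp only [Matrix.of_apply, Matrix.submatrix_apply, key, RCLike.inner_apply]
    ring

theorem IsColumnSchurMultiplier.comp {X Y : Type*} {k : X → X → ℂ} {G : X → ℂ}
    (hG : IsColumnSchurMultiplier k G) (β : Y → X) :
    IsColumnSchurMultiplier (fun z w => k (β z) (β w)) (G ∘ β) :=
  isColumnSchurMultiplier_scalar_iff.2 ((isColumnSchurMultiplier_scalar_iff.1 hG).submatrix β)

/-- Multiplication by a rank one kernel `δ(z) conj δ(w)` with `δ` nowhere zero neither destroys nor
creates positivity. -/
theorem posSemidef_rescale_iff {X : Type*} {K L : Matrix X X ℂ} (δ : X → ℂ) (hδ : ∀ z, δ z ≠ 0)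
    (h : ∀ z w, K z w = δ z * conj (δ w) * L z w) : K.PosSemidef ↔ L.PosSemidef := by
  have hrank : ∀ ε : X → ℂ, (Matrix.of fun z w => ε z * conj (ε w)).PosSemidef := fun ε =>
    posSemidef_congr (posSemidef_inner fun z => conj (ε z)) fun z w => by simp [mul_comm]
  constructor
  · intro hK
    refine posSemidef_congr (posSemidef_mul (hrank fun z => (δ z)⁻¹) hK) fun z w => ?_
    have h1 := hδ z
    have h2 : conj (δ w) ≠ 0 := (map_ne_zero _).2 (hδ w)
    simp only [Matrix.of_apply, h, map_inv₀]
    field_simp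
  · intro hL
    exact posSemidef_congr (posSemidef_mul (hrank δ) hL) fun z w => (h z w).symm

variable {ι : Type*}

/-- The scalar Pick property of the Drury-Arveson kernel: a multiplier of its restriction along `γ`
extends to the whole ball. -/
theorem exists_isColumnSchurMultiplier_extension {Y : Type*} (γ : Y → DABall ι) (s : Y → ℂ)
    (h : IsColumnSchurMultiplier (fun x y => druryArveson ι (γ x) (γ y)) s) :
    ∃ G : DABall ι → ℂ, IsColumnSchurMultiplier (druryArveson ι) G ∧ ∀ y, s y = G (γ y) := by
  obtain ⟨H, _, _, _, ψ, hψ⟩ :=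
    exists_eq_inner_of_posSemidef (isColumnSchurMultiplier_scalar_iff.1 h)
  obtain ⟨G, hG, hs⟩ := exists_isColumnSchurMultiplier_inner_eq γ (fun _ => (1 : ℂ)) s ψ
    fun x y => by
      rw [← hψ]
      have := one_sub_inner_ne_zero (γ x) (γ y)
      simp only [Matrix.of_apply, druryArveson]
      field_simp
      simp
  exact ⟨G, hG, fun y => by simpa using hs y⟩

/-- A Schur multiplier vanishing at `ν` is divisible by the Blaschke factor at `ν`. -/
theorem exists_blaschke_factor {s : DABall ι → ℂ}
    (hs : IsColumnSchurMultiplier (druryArveson ι) s) {ν : DABall ι} (hν : s ν = 0) :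
    ∃ s' : DABall ι → ℓ²(ι, ℂ), IsColumnSchurMultiplier (druryArveson ι) s' ∧
      ∀ l, s l = rowMulColumn (blaschke ν l) (s' l) := by
  obtain ⟨H, _, _, _, ψ, hψ⟩ :=
    exists_eq_inner_of_posSemidef (isColumnSchurMultiplier_scalar_iff.1 hs)
  simp only [Matrix.of_apply] at hψ
  have hl : ∀ l, inner ℂ (ψ l) (ψ ν) = druryArveson ι l ν := fun l => by simp [← hψ, hν]
  have hr : ∀ l, inner ℂ (ψ ν) (ψ l) = druryArveson ι ν l := fun l => by simp [← hψ, hν]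
  have hself : druryArveson ι ν ν = 1 / ((1 - ‖(ν : ℓ²(ι, ℂ))‖ ^ 2 : ℝ) : ℂ) := by
    rw [druryArveson, inner_self_eq_norm_sq_to_K]; push_cast; rfl
  -- Removing from `ψ l` its component along `ψ ν` realizes the Schur complement at `ν`.
  obtain ⟨G, hG, hGs⟩ := exists_isColumnSchurMultiplier_inner_eq (fun l : DABall ι => l)
    (fun l => star (blaschke ν l)) s
    (fun l => ψ l - (druryArveson ι ν l / druryArveson ι ν ν) • ψ ν) fun l μ => by
      rw [inner_star_star, ← sub_sub_cancel 1 (inner ℂ (blaschke ν μ) (blaschke ν l)),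
        one_sub_inner_blaschke]
      have hc : conj (druryArveson ι ν l) = druryArveson ι l ν := by simp [druryArveson]
      have hcs : conj (druryArveson ι ν ν) = druryArveson ι ν ν := by simp [druryArveson]
      have hνν := druryArveson_ne_zero ν ν
      simp only [inner_sub_left, inner_sub_right, inner_smul_left, inner_smul_right, hl, hr,
        map_div₀, hc, hcs, ← hψ]
      have h1 := one_sub_inner_ne_zero l ν
      have h2 := one_sub_inner_ne_zero ν μ
      have h3 := one_sub_inner_ne_zero l μ
      have h4 : ((1 - ‖(ν : ℓ²(ι, ℂ))‖ ^ 2 : ℝ) : ℂ) ≠ 0 := fun h => by simp [hself, h] at hνν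
      rw [hself]
      simp only [druryArveson]
      generalize ((1 - ‖(ν : ℓ²(ι, ℂ))‖ ^ 2 : ℝ) : ℂ) = r at *
      field_simp
      ring
  exact ⟨G, hG, fun l => by rw [hGs, rowMulColumn_eq_inner]⟩

end Scalar

end

theorem mainTheorem1 {κ ι : Type*} (Ω : Set ℓ²(κ, ℂ)) (hΩ_open : IsOpen Ω)
    (hΩ_ball : Ω ⊆ Metric.ball 0 1) (k : Ω → Ω → ℂ) (β : Ω → DABall ι)
    (hk : IsCNPKernelWith k β) :
    (∀ S : Ω → ℂ, IsColumnSchurMultiplier k S ↔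
      ∃ G : DABall ι → ℂ, IsColumnSchurMultiplier (druryArveson ι) G ∧ ∀ z, S z = G (β z)) ∧
    (∀ S : Ω → ℂ, IsColumnSchurMultiplier k S → ∀ w₀ : Ω,
      (S w₀ = 0 ↔ ∃ G₁ : DABall ι → ℓ²(ι, ℂ), IsColumnSchurMultiplier (druryArveson ι) G₁ ∧
        ∀ z, S z = rowMulColumn (blaschke (β w₀) (β z)) (G₁ (β z)))) ∧
    (∀ s : DABall ι → ℂ, IsColumnSchurMultiplier (druryArveson ι) s → ∀ ν : DABall ι,
      (s ν = 0 ↔ ∃ s' : DABall ι → ℓ²(ι, ℂ), IsColumnSchurMultiplier (druryArveson ι) s' ∧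
        ∀ l, s l = rowMulColumn (blaschke ν l) (s' l))) := by
  obtain ⟨δ, hδ, hkδ⟩ := hk.factorization
  have hmult : ∀ S : Ω → ℂ, IsColumnSchurMultiplier k S ↔
      IsColumnSchurMultiplier (fun z w => druryArveson ι (β z) (β w)) S := fun S => by
    rw [isColumnSchurMultiplier_scalar_iff, isColumnSchurMultiplier_scalar_iff]
    exact posSemidef_rescale_iff δ hδ fun z w => by
      rw [Matrix.of_apply, Matrix.of_apply, hkδ, mul_assoc]
  have hext : ∀ S : Ω → ℂ, IsColumnSchurMultiplier k S →
      ∃ G : DABall ι → ℂ, IsColumnSchurMultiplier (druryArveson ι) G ∧ ∀ z, S z = G (β z) :=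
    fun S hS => exists_isColumnSchurMultiplier_extension β S ((hmult S).1 hS)
  have hzero : ∀ (α : DABall ι) (y : ℓ²(ι, ℂ)), rowMulColumn (blaschke α α) y = 0 := fun α y => by
    simp [blaschke_self, rowMulColumn]
  refine ⟨fun S => ⟨hext S, ?_⟩, fun S hS w₀ => ⟨fun h0 => ?_, ?_⟩, fun s hs ν => ⟨fun h0 =>
    exists_blaschke_factor hs h0, ?_⟩⟩
  · rintro ⟨G, hG, hSG⟩
    obtain rfl : S = G ∘ β := funext hSG
    rw [hmult]
    exact hG.comp β
  · obtain ⟨G, hG, hSG⟩ := hext S hS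
    obtain ⟨G₁, hG₁, hfac⟩ := exists_blaschke_factor hG ((hSG w₀).symm.trans h0)
    exact ⟨G₁, hG₁, fun z => (hSG z).trans (hfac _)⟩
  · rintro ⟨G₁, -, hfac⟩
    rw [hfac, hzero]
  · rintro ⟨s', -, hfac⟩
    rw [hfac, hzero]
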